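/- A loop is a set $L$ with a binary operation $\cdot$ and an element $1$ such that $1\cdot x=x=x\cdot 1$ for all $x\in L$ and such that, for all $a,b\in L$, the equations $a\cdot x=b$ and $y\cdot a=b$ have unique solutions $x,y\in L$. Its multiplication group $\mathrm{Mlt}(L)$ is the group of permutations of $L$ generated by all translations $R_a:x\mapsto x\cdot a$ and $L_a:x\mapsto a\cdot x$ ($a\in L$), and its inner mapping group $\mathrm{Inn}(L)$ is the subgroup of those elements of $\mathrm{Mlt}(L)$ that fix $1$. The loop $L$ is automorphic if every element of $\mathrm{Inn}(L)$ is an automorphism of $L$, and uniquely $2$-divisible if the map $x\mapsto x\cdot x$ is a bijection of $L$. Let $(Q,*)$ and $(Q',\cdot)$ be uniquely $2$-divisible automorphic loops (finite or infinite), and let $f:Q\to Q'$ be a half-isomorphism, that is, a bijection such that $f(x*y)\in\{f(x)\cdot f(y),\,f(y)\cdot f(x)\}$ for all $x,y\in Q$. Then $f$ is trivial: either $f(x*y)=f(x)\cdot f(y)$ for all $x,y\in Q$ (so $f$ is an isomorphism), or $f(x*y)=f(y)\cdot f(x)$ for all $x,y\in Q$ (so $f$ is an anti-isomorphism). -/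

import Mathlib

/-- A loop: a set with a binary operation having a two-sided identity element, such that for all
`a b` the equations `a * x = b` and `y * a = b` have unique solutions. -/
class Loop (L : Type*) extends MulOneClass L where
  existsUnique_mul_left_eq : ∀ a b : L, ∃! x : L, a * x = b
  existsUnique_mul_right_eq : ∀ a b : L, ∃! y : L, y * a = b

namespace Loop

theorem bijective_mul_left {L : Type*} [Loop L] (a : L) :
    Function.Bijective (fun x : L => a * x) :=
  (Function.bijective_iff_existsUnique _).2 (existsUnique_mul_left_eq a)

theorem bijective_mul_right {L : Type*} [Loop L] (a : L) :
    Function.Bijective (fun x : L => x * a) :=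
  (Function.bijective_iff_existsUnique _).2 (existsUnique_mul_right_eq a)

/-- The left translation `x ↦ a * x`, as a permutation. -/
noncomputable def leftTranslation {L : Type*} [Loop L] (a : L) : Equiv.Perm L :=
  Equiv.ofBijective (fun x : L => a * x) (bijective_mul_left a)

/-- The right translation `x ↦ x * a`, as a permutation. -/
noncomputable def rightTranslation {L : Type*} [Loop L] (a : L) : Equiv.Perm L :=
  Equiv.ofBijective (fun x : L => x * a) (bijective_mul_right a)

/-- The multiplication group, generated by all left and right translations. -/
def multiplicationGroup (L : Type*) [Loop L] : Subgroup (Equiv.Perm L) :=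
  Subgroup.closure
    (Set.range (rightTranslation : L → Equiv.Perm L) ∪
      Set.range (leftTranslation : L → Equiv.Perm L))

/-- The inner mapping group: the elements of the multiplication group fixing the identity. -/
def innerMappingGroup (L : Type*) [Loop L] : Subgroup (Equiv.Perm L) :=
  multiplicationGroup L ⊓ MulAction.stabilizer (Equiv.Perm L) (1 : L)

/-- A loop is automorphic if every inner mapping is an automorphism. -/
def IsAutomorphic (L : Type*) [Loop L] : Prop :=
  ∀ φ ∈ innerMappingGroup L, ∀ x y : L, φ (x * y) = φ x * φ y

/-- A loop is uniquely 2-divisible if squaring is a bijection. -/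
def IsUniquelyTwoDivisible (L : Type*) [Loop L] : Prop :=
  Function.Bijective (fun x : L => x * x)

/-- A half-isomorphism: a bijection `f` with `f (x * y) ∈ {f x * f y, f y * f x}`. -/
def IsHalfIsomorphism {L L' : Type*} [Loop L] [Loop L'] (f : L → L') : Prop :=
  Function.Bijective f ∧ ∀ x y : L, f (x * y) ∈ ({f x * f y, f y * f x} : Set L')

/-- An isomorphism of loops. -/
def IsIsomorphism {L L' : Type*} [Loop L] [Loop L'] (f : L → L') : Prop :=
  Function.Bijective f ∧ ∀ x y : L, f (x * y) = f x * f y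

/-- An anti-isomorphism of loops. -/
def IsAntiIsomorphism {L L' : Type*} [Loop L] [Loop L'] (f : L → L') : Prop :=
  Function.Bijective f ∧ ∀ x y : L, f (x * y) = f y * f x

/-- A map is trivial (as a half-isomorphism) if it is an isomorphism or an anti-isomorphism. -/
def IsTrivialHalfIsomorphism {L L' : Type*} [Loop L] [Loop L'] (f : L → L') : Prop :=
  IsIsomorphism f ∨ IsAntiIsomorphism f

end Loop

/-! The Bruck translations 𝓟ₓ (y ↦ xyx in a group) make no choice between left and right, so a
half-isomorphism preserves them exactly (`map_bruckTranslation`), and automorphisms do too. With T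
the conjugation, y·x = x·Tₓy makes f(Tₓy) equal to T(fy) or T⁻¹(fy), T being taken at f x, with a
sign that might depend on y. All three maps are homomorphisms for 𝓟, and unique 2-divisibility makes
the sign uniform in y (`IsBruckHom.eq_or_eq`), much as a group is not the union of two proper
subgroups. Conjugations have no 2-cycles, so the sign fixes the order of the factors in every f(x·y)
with x given (`map_mul_or`). A second union argument, with centralizers, makes that order
independent of x. -/

namespace Loop

/-! ### Translations and inner mappings -/

section Automorphic

local notation "𝓛" => leftTranslation
local notation "𝓡" => rightTranslation

variable {L : Type*} [Loop L]

@[simp] theorem leftTranslation_apply (a x : L) : 𝓛 a x = a * x := rfl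

@[simp] theorem rightTranslation_apply (a x : L) : 𝓡 a x = x * a := rfl

theorem mul_left_cancel' {a x y : L} (h : a * x = a * y) : x = y :=
  (bijective_mul_left a).1 h

theorem mul_right_cancel' {a x y : L} (h : x * a = y * a) : x = y :=
  (bijective_mul_right a).1 h

theorem perm_apply_inv {α : Type*} (σ : Equiv.Perm α) (x : α) : σ (σ⁻¹ x) = x :=
  σ.apply_symm_apply x

theorem leftTranslation_mem (a : L) : 𝓛 a ∈ multiplicationGroup L :=
  Subgroup.subset_closure (Or.inr ⟨a, rfl⟩)

theorem rightTranslation_mem (a : L) : 𝓡 a ∈ multiplicationGroup L :=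
  Subgroup.subset_closure (Or.inl ⟨a, rfl⟩)

theorem leftTranslation_one : 𝓛 (1 : L) = 1 := by
  ext x; simp

theorem rightTranslation_one : 𝓡 (1 : L) = 1 := by
  ext x; simp

theorem leftTranslation_inv_eq_iff {a x y : L} : (𝓛 a)⁻¹ x = y ↔ x = a * y := by
  rw [Equiv.Perm.inv_eq_iff_eq, leftTranslation_apply]

theorem rightTranslation_inv_eq_iff {a x y : L} : (𝓡 a)⁻¹ x = y ↔ x = y * a := by
  rw [Equiv.Perm.inv_eq_iff_eq, rightTranslation_apply]

theorem mem_innerMappingGroup_iff {σ : Equiv.Perm L} :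
    σ ∈ innerMappingGroup L ↔ σ ∈ multiplicationGroup L ∧ σ 1 = 1 := by
  rw [innerMappingGroup, Subgroup.mem_inf, MulAction.mem_stabilizer_iff, Equiv.Perm.smul_def]

/-- The right inverse of an element; it is two-sided in an automorphic loop. -/
noncomputable def inverse (a : L) : L := (𝓛 a)⁻¹ 1

local notation "ι" => inverse

theorem mul_inverse (a : L) : a * ι a = 1 :=
  (leftTranslation_inv_eq_iff.1 rfl).symm

theorem eq_inverse_of_mul_eq_one {a b : L} (h : a * b = 1) : b = ι a :=
  mul_left_cancel' (h.trans (mul_inverse a).symm)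

theorem inverse_one : ι (1 : L) = 1 := (eq_inverse_of_mul_eq_one (one_mul 1)).symm

/-- The conjugation-like inner mapping `y ↦ x \ (y * x)`. -/
noncomputable def conjugation (x : L) : Equiv.Perm L := (𝓛 x)⁻¹ * 𝓡 x

theorem mul_conjugation (x y : L) : x * conjugation x y = y * x := by
  rw [← leftTranslation_apply, conjugation, Equiv.Perm.mul_apply, perm_apply_inv,
    rightTranslation_apply]

theorem conjugation_eq_self_iff {x y : L} : conjugation x y = y ↔ x * y = y * x := by
  rw [← mul_conjugation x y]
  exact ⟨fun h => by rw [h], fun h => (mul_left_cancel' h).symm⟩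

theorem conjugation_mem (x : L) : conjugation x ∈ innerMappingGroup L := by
  refine mem_innerMappingGroup_iff.2
    ⟨mul_mem (inv_mem (leftTranslation_mem x)) (rightTranslation_mem x), ?_⟩
  exact conjugation_eq_self_iff.2 (by simp)

/-- The left inner mapping `z ↦ (x * y) \ (x * (y * z))`. -/
noncomputable def leftInner (x y : L) : Equiv.Perm L := (𝓛 (x * y))⁻¹ * 𝓛 x * 𝓛 y

theorem leftInner_mem (x y : L) : leftInner x y ∈ innerMappingGroup L := by
  refine mem_innerMappingGroup_iff.2 ⟨mul_mem (mul_mem (inv_mem (leftTranslation_mem _))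
    (leftTranslation_mem x)) (leftTranslation_mem y), ?_⟩
  simp only [leftInner, Equiv.Perm.mul_apply, leftTranslation_inv_eq_iff, leftTranslation_apply,
    mul_one]

/-- The Bruck translation `y ↦ x⁻¹ \ (y * x)`, which is `y ↦ x * y * x` in a group. -/
noncomputable def bruckTranslation (x : L) : Equiv.Perm L := 𝓡 x * (𝓛 (ι x))⁻¹

local notation "𝓟" => bruckTranslation

theorem map_one_of_mem {σ : Equiv.Perm L} (hσ : σ ∈ innerMappingGroup L) : σ 1 = 1 :=
  (mem_innerMappingGroup_iff.1 hσ).2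

/-! ### Inverses in automorphic loops -/

namespace IsAutomorphic

theorem mul_leftTranslation (hL : IsAutomorphic L) {σ : Equiv.Perm L}
    (hσ : σ ∈ innerMappingGroup L) (a : L) : σ * 𝓛 a = 𝓛 (σ a) * σ := by
  ext x; simp [hL σ hσ]

theorem commute_leftTranslation (hL : IsAutomorphic L) {σ : Equiv.Perm L}
    (hσ : σ ∈ innerMappingGroup L) {a : L} (ha : σ a = a) : Commute σ (𝓛 a) := by
  have h := hL.mul_leftTranslation hσ a
  rwa [ha] at h

theorem map_inverse (hL : IsAutomorphic L) {σ : Equiv.Perm L}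
    (hσ : σ ∈ innerMappingGroup L) (a : L) : σ (ι a) = ι (σ a) :=
  eq_inverse_of_mul_eq_one (by rw [← hL σ hσ, mul_inverse, map_one_of_mem hσ])

theorem rightTranslation_eq (a : L) : 𝓡 a = 𝓛 a * conjugation a := by
  rw [conjugation, mul_inv_cancel_left]

theorem commute_translations (hL : IsAutomorphic L) (a : L) : Commute (𝓛 a) (𝓡 a) := by
  rw [rightTranslation_eq]
  exact (Commute.refl _).mul_right
    (hL.commute_leftTranslation (conjugation_mem a) (conjugation_eq_self_iff.2 rfl)).symm

theorem flexible (hL : IsAutomorphic L) (x y : L) : x * (y * x) = (x * y) * x :=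
  DFunLike.congr_fun (hL.commute_translations x).eq y

theorem conjugation_inverse (hL : IsAutomorphic L) (x : L) : conjugation x (ι x) = ι x := by
  rw [hL.map_inverse (conjugation_mem x), conjugation_eq_self_iff.2 rfl]

theorem inverse_mul (hL : IsAutomorphic L) (a : L) : ι a * a = 1 := by
  rw [← conjugation_eq_self_iff.1 (hL.conjugation_inverse a), mul_inverse]

theorem inverse_inverse (hL : IsAutomorphic L) (a : L) : ι (ι a) = a :=
  (eq_inverse_of_mul_eq_one (hL.inverse_mul a)).symm

theorem leftInner_apply_left (hL : IsAutomorphic L) (x y : L) : leftInner x y x = x := by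
  simp only [leftInner, Equiv.Perm.mul_apply, leftTranslation_inv_eq_iff, leftTranslation_apply]
  exact hL.flexible x y

theorem leftInner_self_inverse (a : L) : leftInner a (ι a) = 𝓛 a * 𝓛 (ι a) := by
  rw [leftInner, mul_inverse, leftTranslation_one, inv_one, one_mul]

/-- The product 𝓛 a * 𝓛 (ι a) is an inner mapping that fixes a, so it commutes with 𝓛 a; cancel one
𝓛 a. -/
theorem commute_leftTranslation_inverse (hL : IsAutomorphic L) (a : L) :
    Commute (𝓛 a) (𝓛 (ι a)) := by
  have h := hL.commute_leftTranslation (leftInner_mem a (ι a)) (hL.leftInner_apply_left a (ι a))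
  rw [leftInner_self_inverse] at h
  exact (mul_left_cancel (a := 𝓛 a) (by simpa [mul_assoc] using h.eq)).symm

theorem commute_right_left_inverse (hL : IsAutomorphic L) (a : L) :
    Commute (𝓡 a) (𝓛 (ι a)) := by
  rw [rightTranslation_eq]
  exact (hL.commute_leftTranslation_inverse a).mul_left
    (hL.commute_leftTranslation (conjugation_mem a) (hL.conjugation_inverse a))

theorem commute_left_right_inverse (hL : IsAutomorphic L) (a : L) :
    Commute (𝓛 a) (𝓡 (ι a)) := by
  simpa [hL.inverse_inverse] using (hL.commute_right_left_inverse (ι a)).symm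

theorem leftInner_apply_inverse (x y : L) :
    leftInner x y (ι y) = (𝓛 (x * y))⁻¹ x := by
  simp [leftInner, mul_inverse]

/-- Two consecutive left inner mappings compose to `𝓛 y * 𝓛 y⁻¹`. -/
theorem leftInner_mul_leftInner (hL : IsAutomorphic L) {x y z u : L} (hz : z = x * y)
    (hu : x = z * u) : leftInner z u * leftInner x y = 𝓛 y * 𝓛 (ι y) := by
  have h1 : leftInner x y (ι y) = u := by
    rw [leftInner_apply_inverse, leftTranslation_inv_eq_iff, ← hz, ← hu]
  have h2 := hL.mul_leftTranslation (leftInner_mem x y) (ι y)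
  rw [h1] at h2
  calc leftInner z u * leftInner x y = (𝓛 x)⁻¹ * 𝓛 z * (𝓛 u * leftInner x y) := by
        rw [leftInner, ← hu]; simp only [mul_assoc]
    _ = 𝓛 y * 𝓛 (ι y) := by
        rw [← h2, leftInner, ← hz]; group

theorem mul_inverse_mul (hL : IsAutomorphic L) (x y : L) :
    y * (ι y * x) = (x * y) * ι y := by
  -- With (xy)u = x, the map 𝓛 y * 𝓛 (ι y) factors into two inner mappings. The first fixes x; the
  -- second fixes xy and sends u to y⁻¹, hence x to (xy)y⁻¹.
  obtain ⟨u, hu, -⟩ := existsUnique_mul_left_eq (x * y) x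
  have hg := hL.leftInner_mul_leftInner rfl hu.symm
  have key (w : L) : leftInner (x * y) u (leftInner x y w) = y * (ι y * w) :=
    DFunLike.congr_fun hg w
  have hmem := leftInner_mem (x * y) u
  have h1 : leftInner (x * y) u u = ι y := by
    have h := key (ι y)
    rw [leftInner_apply_inverse, leftTranslation_inv_eq_iff.2 hu.symm] at h
    rw [h]
    have h3 := hL.map_inverse (leftInner_mem y (ι y)) y
    rw [hL.leftInner_apply_left, leftInner_self_inverse] at h3
    exact h3
  have h2 := hL _ hmem (x * y) u
  rw [hu, h1, hL.leftInner_apply_left] at h2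
  rw [← key x, hL.leftInner_apply_left, h2]

theorem left_mul_left_inverse (hL : IsAutomorphic L) (y : L) :
    𝓛 y * 𝓛 (ι y) = 𝓡 (ι y) * 𝓡 y := by
  ext x; exact hL.mul_inverse_mul x y

/-- Automorphic loops have the antiautomorphic inverse property. -/
theorem inverse_mul_rev (hL : IsAutomorphic L) (x y : L) : ι (x * y) = ι y * ι x := by
  obtain ⟨u, hu, -⟩ := existsUnique_mul_left_eq (x * y) x
  have hg := hL.leftInner_mul_leftInner rfl hu.symm
  -- The second factor fixes xy and so its inverse; evaluating the composite at y\x⁻¹ gives the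
  -- identity.
  have h1 : leftInner x y ((𝓛 y)⁻¹ (ι x)) = ι (x * y) := by
    simp [leftInner, inverse]
  have h2 := hL.map_inverse (leftInner_mem (x * y) u) (x * y)
  rw [hL.leftInner_apply_left, ← h1, ← Equiv.Perm.mul_apply, hg, h1,
    (hL.commute_leftTranslation_inverse y).eq] at h2
  simpa using h2.symm

theorem inverse_injective (hL : IsAutomorphic L) : Function.Injective (ι : L → L) :=
  Function.LeftInverse.injective hL.inverse_inverse

/-- Conjugating an inner mapping by inversion does nothing; on translations it swaps sides. -/
theorem inner_eq_of_semiconj (hL : IsAutomorphic L) {σ τ : Equiv.Perm L}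
    (hσ : σ ∈ innerMappingGroup L) (h : ∀ x, ι (σ x) = τ (ι x)) : σ = τ := by
  ext x
  rw [← hL.inverse_inverse x, ← h, hL.map_inverse hσ]

theorem inverse_left (hL : IsAutomorphic L) (a x : L) : ι (𝓛 a x) = 𝓡 (ι a) (ι x) :=
  hL.inverse_mul_rev a x

theorem inverse_right (hL : IsAutomorphic L) (a x : L) : ι (𝓡 a x) = 𝓛 (ι a) (ι x) :=
  hL.inverse_mul_rev x a

theorem inverse_left_inv (hL : IsAutomorphic L) (a x : L) :
    ι ((𝓛 a)⁻¹ x) = (𝓡 (ι a))⁻¹ (ι x) := by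
  rw [Equiv.Perm.eq_inv_iff_eq, ← hL.inverse_left, perm_apply_inv]

theorem inverse_right_inv (hL : IsAutomorphic L) (a x : L) :
    ι ((𝓡 a)⁻¹ x) = (𝓛 (ι a))⁻¹ (ι x) := by
  rw [Equiv.Perm.eq_inv_iff_eq, ← hL.inverse_right, perm_apply_inv]

/-! ### Bruck translations -/

theorem bruckTranslation_eq (hL : IsAutomorphic L) (x : L) : 𝓟 x = 𝓛 x * (𝓡 (ι x))⁻¹ := by
  have h := hL.left_mul_left_inverse (ι x)
  rw [hL.inverse_inverse] at h
  rw [bruckTranslation, (hL.commute_right_left_inverse x).inv_right.eq, eq_mul_inv_iff_mul_eq,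
    mul_assoc, ← h, inv_mul_cancel_left]

theorem bruckTranslation_inverse (hL : IsAutomorphic L) (x : L) : 𝓟 (ι x) = (𝓟 x)⁻¹ := by
  rw [hL.bruckTranslation_eq, hL.inverse_inverse, bruckTranslation, mul_inv_rev, inv_inv]

theorem inverse_bruckTranslation (hL : IsAutomorphic L) (x y : L) :
    ι (𝓟 x y) = 𝓟 (ι x) (ι y) := by
  rw [hL.bruckTranslation_eq (ι x), bruckTranslation, Equiv.Perm.mul_apply, Equiv.Perm.mul_apply,
    hL.inverse_right, hL.inverse_left_inv]

theorem bruckTranslation_mul_inverse (hL : IsAutomorphic L) (x z : L) :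
    𝓟 x (z * ι x) = x * z := by
  rw [hL.bruckTranslation_eq, Equiv.Perm.mul_apply, rightTranslation_inv_eq_iff.2 rfl,
    leftTranslation_apply]

theorem bruckTranslation_inverse_mul (x z : L) : 𝓟 x (ι x * z) = z * x := by
  rw [bruckTranslation, Equiv.Perm.mul_apply, leftTranslation_inv_eq_iff.2 rfl,
    rightTranslation_apply]

theorem inverse_mul_bruckTranslation (hL : IsAutomorphic L) (x y : L) :
    ι x * 𝓟 x y = y * x := by
  rw [bruckTranslation, (hL.commute_right_left_inverse x).inv_right.eq,
    ← leftTranslation_apply (ι x)]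
  simp

theorem bruckTranslation_mul_inverse' (hL : IsAutomorphic L) (x y : L) :
    𝓟 x y * ι x = x * y := by
  rw [hL.bruckTranslation_eq, (hL.commute_left_right_inverse x).inv_right.eq,
    ← rightTranslation_apply (ι x)]
  simp

theorem bruckTranslation_one_apply : 𝓟 (1 : L) = 1 := by
  rw [bruckTranslation, inverse_one, leftTranslation_one, rightTranslation_one, inv_one, one_mul]

theorem bruckTranslation_apply_one (hL : IsAutomorphic L) (x : L) : 𝓟 x 1 = x * x := by
  simpa [mul_inverse] using hL.bruckTranslation_mul_inverse x x

theorem leftInner_eq_right (hL : IsAutomorphic L) (x y : L) :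
    leftInner x y = (𝓡 (ι y * ι x))⁻¹ * 𝓡 (ι x) * 𝓡 (ι y) := by
  refine hL.inner_eq_of_semiconj (leftInner_mem x y) fun z => ?_
  simp only [leftInner, Equiv.Perm.mul_apply, hL.inverse_left_inv, hL.inverse_left,
    hL.inverse_mul_rev]

/-- Inversion commutes with inner mappings, so 𝓛 (xy) and 𝓡 (xy)⁻¹ differ from products of
translations by the same inner mapping, which cancels in the quotient 𝓟 (xy). -/
theorem bruckTranslation_mul (hL : IsAutomorphic L) (x y : L) :
    𝓟 (x * y) * 𝓡 (ι x) = 𝓛 x * 𝓟 y := by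
  have h1 : 𝓛 (x * y) = 𝓛 x * 𝓛 y * (leftInner x y)⁻¹ := by rw [leftInner]; group
  have h2 : 𝓡 (ι (x * y)) = 𝓡 (ι x) * 𝓡 (ι y) * (leftInner x y)⁻¹ := by
    rw [hL.leftInner_eq_right, hL.inverse_mul_rev]; group
  rw [hL.bruckTranslation_eq, hL.bruckTranslation_eq, h1, h2]
  group

theorem mul_self_mul (hL : IsAutomorphic L) (x y : L) : (x * y) * (x * y) = x * 𝓟 y x := by
  have h := DFunLike.congr_fun (hL.bruckTranslation_mul x y) x
  simpa [mul_inverse, hL.bruckTranslation_apply_one] using h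

theorem mul_self_mul' (hL : IsAutomorphic L) (x y : L) : (x * y) * (x * y) = 𝓟 x y * y := by
  apply hL.inverse_injective
  rw [hL.inverse_mul_rev, hL.inverse_mul_rev x y, hL.mul_self_mul, hL.inverse_mul_rev,
    hL.inverse_bruckTranslation]

/-- For w = 𝓟ₓy, the relation x⁻¹w = yx yields an inner mapping α, and the commutator of 𝓛 y with 𝓡
x an inner mapping e. Inversion swaps left and right but fixes α and e, so both cancel from 𝓛 w * (𝓡
(ι w))⁻¹. -/
theorem bruckTranslation_bruckTranslation (hL : IsAutomorphic L) (x y : L) :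
    𝓟 (𝓟 x y) = 𝓟 x * 𝓟 y * 𝓟 x := by
  have hw := hL.inverse_mul_bruckTranslation x y
  generalize 𝓟 x y = w at hw ⊢
  set α : Equiv.Perm L := (𝓛 y * 𝓛 x)⁻¹ * 𝓛 (ι x) * 𝓛 w with hα
  have hα_mem : α ∈ innerMappingGroup L := by
    refine mem_innerMappingGroup_iff.2 ⟨mul_mem (mul_mem (inv_mem (mul_mem (leftTranslation_mem _)
      (leftTranslation_mem _))) (leftTranslation_mem _)) (leftTranslation_mem _), ?_⟩
    simp only [hα, Equiv.Perm.mul_apply, Equiv.Perm.inv_eq_iff_eq, leftTranslation_apply, mul_one,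
      hw]
  have hα' : α = (𝓡 (ι y) * 𝓡 (ι x))⁻¹ * 𝓡 x * 𝓡 (ι w) := by
    refine hL.inner_eq_of_semiconj hα_mem fun z => ?_
    simp only [hα, mul_inv_rev, Equiv.Perm.mul_apply, hL.inverse_left_inv, hL.inverse_left,
      hL.inverse_inverse]
  set e : Equiv.Perm L := (𝓡 x * 𝓛 y)⁻¹ * 𝓛 y * 𝓡 x with he
  have he_mem : e ∈ innerMappingGroup L := by
    refine mem_innerMappingGroup_iff.2 ⟨mul_mem (mul_mem (inv_mem (mul_mem
      (rightTranslation_mem _) (leftTranslation_mem _))) (leftTranslation_mem _))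
      (rightTranslation_mem _), ?_⟩
    simp only [he, Equiv.Perm.mul_apply, Equiv.Perm.inv_eq_iff_eq, leftTranslation_apply,
      rightTranslation_apply, mul_one, one_mul]
  have he' : e = (𝓛 (ι x) * 𝓡 (ι y))⁻¹ * 𝓡 (ι y) * 𝓛 (ι x) := by
    refine hL.inner_eq_of_semiconj he_mem fun z => ?_
    simp only [he, mul_inv_rev, Equiv.Perm.mul_apply, hL.inverse_left_inv, hL.inverse_left,
      hL.inverse_right, hL.inverse_right_inv]
  have h1 : 𝓛 w = (𝓛 (ι x))⁻¹ * 𝓛 y * 𝓛 x * α := by rw [hα]; group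
  have h2 : 𝓡 (ι w) = (𝓡 x)⁻¹ * 𝓡 (ι y) * 𝓡 (ι x) * α := by rw [hα']; group
  have h3 : 𝓛 y * 𝓡 x = 𝓡 x * 𝓛 y * e := by rw [he]; group
  have h4 : 𝓡 (ι y) * 𝓛 (ι x) = 𝓛 (ι x) * 𝓡 (ι y) * e := by rw [he']; group
  have hc := (hL.commute_right_left_inverse x).inv_right.eq
  calc 𝓟 w = (𝓛 (ι x))⁻¹ * 𝓛 y * (𝓛 x * (𝓡 (ι x))⁻¹) * (𝓡 (ι y))⁻¹ * 𝓡 x := by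
        rw [hL.bruckTranslation_eq, h1, h2]; group
    _ = (𝓛 (ι x))⁻¹ * (𝓛 y * 𝓡 x) * (𝓡 (ι y) * 𝓛 (ι x))⁻¹ * 𝓡 x := by
        rw [← hL.bruckTranslation_eq, bruckTranslation]; group
    _ = ((𝓛 (ι x))⁻¹ * 𝓡 x) * (𝓛 y * (𝓡 (ι y))⁻¹) * ((𝓛 (ι x))⁻¹ * 𝓡 x) := by
        rw [h3, h4]; group
    _ = 𝓟 x * 𝓟 y * 𝓟 x := by
        rw [← hc, ← hL.bruckTranslation_eq, ← bruckTranslation]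

/-- The hypothesis says that 𝓟ₖ fixes x = t². Then 𝓟ₜk and t² = 𝓟ₜ1 have the same square, so they
agree and k = 1. -/
theorem eq_one_of_conjugation_eq_inverse (hL : IsAutomorphic L) (hd : IsUniquelyTwoDivisible L)
    {x k : L} (h : conjugation x k = ι k) : k = 1 := by
  have hk : k * x = x * ι k := by rw [← h, mul_conjugation]
  have hP : 𝓟 k x = x := mul_right_cancel' ((hL.bruckTranslation_mul_inverse' k x).trans hk)
  obtain ⟨t, rfl⟩ := hd.2 x
  simp only at hP
  have hsq : 𝓟 t k * 𝓟 t k = (t * t) * (t * t) := by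
    rw [← hL.bruckTranslation_apply_one, hL.bruckTranslation_bruckTranslation,
      Equiv.Perm.mul_apply, Equiv.Perm.mul_apply, hL.bruckTranslation_apply_one, hP,
      ← hL.bruckTranslation_apply_one (t * t), ← hL.bruckTranslation_apply_one t,
      hL.bruckTranslation_bruckTranslation, bruckTranslation_one_apply]
    rfl
  have := hd.1 hsq
  rw [← hL.bruckTranslation_apply_one] at this
  exact (𝓟 t).injective this

/-- A conjugation of a uniquely 2-divisible automorphic loop has no 2-cycles. -/
theorem conjugation_eq_self_of_sq (hL : IsAutomorphic L) (hd : IsUniquelyTwoDivisible L)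
    {x u : L} (h : conjugation x (conjugation x u) = u) : conjugation x u = u := by
  -- If conjugation swaps u and v, it sends uv⁻¹ to vu⁻¹ = (uv⁻¹)⁻¹.
  have hk : u * ι (conjugation x u) = 1 := by
    refine hL.eq_one_of_conjugation_eq_inverse hd (x := x) ?_
    rw [hL _ (conjugation_mem x), hL.map_inverse (conjugation_mem x), h, hL.inverse_mul_rev,
      hL.inverse_inverse]
  exact mul_right_cancel' ((mul_inverse _).trans hk.symm)

end IsAutomorphic

end Automorphic

/-! ### Half-isomorphisms and the Bruck structure -/

section HalfIsomorphism

local notation "ι" => inverse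
local notation "𝓟" => bruckTranslation

variable {Q Q' : Type*} [Loop Q] [Loop Q'] {f : Q → Q'}

namespace IsHalfIsomorphism

theorem map_mul (hf : IsHalfIsomorphism f) (x y : Q) :
    f (x * y) = f x * f y ∨ f (x * y) = f y * f x := by
  simpa using hf.2 x y

theorem map_mul_self (hf : IsHalfIsomorphism f) (x : Q) : f (x * x) = f x * f x := by
  simpa using hf.map_mul x x

theorem map_one (hf : IsHalfIsomorphism f) : f 1 = 1 := by
  have h := hf.map_mul_self 1
  rw [mul_one] at h
  exact mul_left_cancel' (h.symm.trans (mul_one _).symm)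

theorem map_inverse (hf : IsHalfIsomorphism f) (hQ' : IsAutomorphic Q') (x : Q) :
    f (ι x) = ι (f x) := by
  rcases hf.map_mul x (ι x) with h | h <;> rw [mul_inverse, hf.map_one] at h
  · exact eq_inverse_of_mul_eq_one h.symm
  · exact mul_right_cancel' (h.symm.trans (hQ'.inverse_mul _).symm)

/-- Apply f to y⁻¹·𝓟ᵧx = xy. If the orders chosen on the two sides match, cancellation suffices; if
not, the square (xy)² = x·𝓟ᵧx decides, in either order of its factors. -/
theorem map_bruckTranslation (hf : IsHalfIsomorphism f) (hQ : IsAutomorphic Q)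
    (hQ' : IsAutomorphic Q') (x y : Q) :
    f (𝓟 y x) = 𝓟 (f y) (f x) := by
  have hc := hf.map_mul x y
  have hu := hf.map_mul (ι y) (𝓟 y x)
  have hsq := hf.map_mul x (𝓟 y x)
  rw [hQ.inverse_mul_bruckTranslation, hf.map_inverse hQ'] at hu
  rw [← hQ.mul_self_mul, hf.map_mul_self] at hsq
  have hu1 := hQ'.mul_self_mul (f (𝓟 y x)) (ι (f y))
  have hu2 := hQ'.mul_self_mul' (ι (f y)) (f (𝓟 y x))
  rw [hQ'.bruckTranslation_inverse] at hu1 hu2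
  generalize f (𝓟 y x) = u at *
  generalize f (x * y) = c at *
  rcases hc with hc | hc <;> rcases hu with hu | hu
  · exact mul_left_cancel' (hu.symm.trans (hc.trans (hQ'.inverse_mul_bruckTranslation _ _).symm))
  · rcases hsq with h | h
    · rw [hc, hQ'.mul_self_mul] at h
      exact (mul_left_cancel' h).symm
    · rw [← hu, h] at hu1
      exact Equiv.Perm.inv_eq_iff_eq.1 (mul_left_cancel' hu1).symm
  · rcases hsq with h | h
    · rw [← hu, h] at hu2
      exact Equiv.Perm.inv_eq_iff_eq.1 (mul_right_cancel' hu2).symm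
    · rw [hc, hQ'.mul_self_mul'] at h
      exact (mul_right_cancel' h).symm
  · exact mul_right_cancel'
      (hu.symm.trans (hc.trans (hQ'.bruckTranslation_mul_inverse' _ _).symm))

/-- The order of the factors in `f (x * y)` determines that in `f (y * x⁻¹)`. -/
theorem map_mul_inverse (hf : IsHalfIsomorphism f) (hQ : IsAutomorphic Q)
    (hQ' : IsAutomorphic Q') (x y : Q) :
    (f (x * y) = f x * f y → f (y * ι x) = f y * ι (f x)) ∧
      (f (x * y) = f y * f x → f (y * ι x) = ι (f x) * f y) := by
  have h := hf.map_bruckTranslation hQ hQ' (y * ι x) x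
  rw [hQ.bruckTranslation_mul_inverse] at h
  refine ⟨fun h' => (𝓟 (f x)).injective ?_, fun h' => (𝓟 (f x)).injective ?_⟩
  · rw [← h, h', hQ'.bruckTranslation_mul_inverse]
  · rw [← h, h', IsAutomorphic.bruckTranslation_inverse_mul]

/-- Since xy = yx, `map_mul_inverse` applies with both orders, to yx⁻¹ and to its inverse xy⁻¹.
Comparing them shows that f y commutes with (f x)⁻¹, hence with f x. -/
theorem map_mul_comm (hf : IsHalfIsomorphism f) (hQ : IsAutomorphic Q)
    (hQ' : IsAutomorphic Q') {x y : Q} (hxy : x * y = y * x) : f x * f y = f y * f x := by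
  wlog h : f (x * y) = f x * f y generalizing x y
  · refine (this hxy.symm ?_).symm
    rw [← hxy]
    exact (hf.map_mul x y).resolve_left h
  have h1 := (hf.map_mul_inverse hQ hQ' x y).1 h
  have h2 := (hf.map_mul_inverse hQ hQ' y x).2 (by rw [← hxy, h])
  have h3 : ι (f (x * ι y)) = f (y * ι x) := by
    rw [← hf.map_inverse hQ', hQ.inverse_mul_rev, hQ.inverse_inverse]
  rw [h2, hQ'.inverse_mul_rev, hQ'.inverse_inverse, h1] at h3
  have h4 := hQ'.map_inverse (conjugation_mem (f y)) (ι (f x))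
  rw [conjugation_eq_self_iff.2 h3.symm, hQ'.inverse_inverse] at h4
  exact (conjugation_eq_self_iff.1 h4).symm

end IsHalfIsomorphism

/-- The homomorphisms of the Bruck structure of a loop. -/
def IsBruckHom (S : Q → Q') : Prop :=
  S 1 = 1 ∧ ∀ x y, S (𝓟 y x) = 𝓟 (S y) (S x)

theorem IsBruckHom.map_mul_self (hQ : IsAutomorphic Q) (hQ' : IsAutomorphic Q') {S : Q → Q'}
    (hS : IsBruckHom S) (x : Q) : S (x * x) = S x * S x := by
  rw [← hQ.bruckTranslation_apply_one, hS.2, hS.1, hQ'.bruckTranslation_apply_one]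

/-- If three homomorphisms of Bruck structures are such that the first agrees at every point with
one of the other two, then it coincides with one of them. -/
theorem IsBruckHom.eq_or_eq (hQ : IsAutomorphic Q) (hQ' : IsAutomorphic Q')
    (hdQ : IsUniquelyTwoDivisible Q) (hdQ' : IsUniquelyTwoDivisible Q') {T S U : Q → Q'}
    (hT : IsBruckHom T) (hS : IsBruckHom S) (hU : IsBruckHom U)
    (h : ∀ y, T y = S y ∨ T y = U y) : (∀ y, T y = S y) ∨ ∀ y, T y = U y := by
  have cancel {V : Q → Q'} (hV : IsBruckHom V) {a b : Q} (ha : T a = V a)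
      (hab : T (𝓟 a b) = V (𝓟 a b)) : T b = V b := by
    rw [hT.2, hV.2, ha] at hab
    exact (𝓟 (V a)).injective hab
  by_contra! hne
  -- T agrees with S but not U at a, and with U but not S at b; so it agrees with U at 𝓟ₐb, since
  -- agreement with S would pass to b.
  obtain ⟨⟨b, hb⟩, a, ha⟩ := hne
  have haS := (h a).resolve_right ha
  have hbU := (h b).resolve_left hb
  have hab := (h (𝓟 a b)).resolve_left fun h' => hb (cancel hS haS h')
  -- A left factor of 𝓟ₐb cannot be cancelled directly. With b = t², one has (𝓟ₜa)² = 𝓟ₜ(𝓟ₐb), so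
  -- agreement of T and U passes to this square, to 𝓟ₜa, and to a.
  obtain ⟨t, rfl⟩ := hdQ.2 b
  simp only at hbU hab
  have ht : T t = U t := by
    rw [hT.map_mul_self hQ hQ', hU.map_mul_self hQ hQ'] at hbU
    exact hdQ'.1 hbU
  refine ha (cancel hU ht (hdQ'.1 ?_))
  simp only
  rw [← hT.map_mul_self hQ hQ', ← hU.map_mul_self hQ hQ', ← hQ.bruckTranslation_apply_one,
    hQ.bruckTranslation_bruckTranslation, Equiv.Perm.mul_apply, Equiv.Perm.mul_apply,
    hQ.bruckTranslation_apply_one, hT.2, hU.2, ht, hab]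

theorem IsBruckHom.comp {Q'' : Type*} [Loop Q''] {S : Q' → Q''} {T : Q → Q'}
    (hS : IsBruckHom S) (hT : IsBruckHom T) : IsBruckHom (S ∘ T) :=
  ⟨by simp [hT.1, hS.1], fun x y => by simp [hT.2, hS.2]⟩

theorem IsAutomorphic.isBruckHom (hQ : IsAutomorphic Q) {σ : Equiv.Perm Q}
    (hσ : σ ∈ innerMappingGroup Q) : IsBruckHom σ := by
  refine ⟨map_one_of_mem hσ, fun x y => mul_left_cancel' (a := ι (σ y)) ?_⟩
  rw [hQ.inverse_mul_bruckTranslation, ← hQ.map_inverse hσ, ← hQ σ hσ,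
    hQ.inverse_mul_bruckTranslation, hQ σ hσ]

/-! ### Triviality of half-isomorphisms -/

namespace IsHalfIsomorphism

theorem isBruckHom (hf : IsHalfIsomorphism f) (hQ : IsAutomorphic Q)
    (hQ' : IsAutomorphic Q') : IsBruckHom f :=
  ⟨hf.map_one, hf.map_bruckTranslation hQ hQ'⟩

theorem map_conjugation_or (hf : IsHalfIsomorphism f) (hQ : IsAutomorphic Q)
    (hQ' : IsAutomorphic Q') (x y : Q) :
    f (conjugation x y) = conjugation (f x) (f y) ∨
      f (conjugation x y) = (conjugation (f x))⁻¹ (f y) := by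
  have hcomm (h : conjugation x y = y) : f (conjugation x y) = conjugation (f x) (f y) := by
    rw [h, conjugation_eq_self_iff.2 (hf.map_mul_comm hQ hQ' (conjugation_eq_self_iff.1 h))]
  have h := hf.map_mul x (conjugation x y)
  rw [mul_conjugation, ← mul_conjugation (f x) (f (conjugation x y))] at h
  rcases hf.map_mul y x with h1 | h1 <;> rw [h1] at h
  · rw [← mul_conjugation (f x) (f y)] at h
    rcases h with h | h
    · exact Or.inl (mul_left_cancel' h).symm
    · exact Or.inl (hcomm (hf.1.1 ((conjugation (f x)).injective (mul_left_cancel' h))).symm)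
  · rcases h with h | h
    · exact Or.inl (hcomm (hf.1.1 (mul_left_cancel' h)).symm)
    · exact Or.inr (Equiv.Perm.eq_inv_iff_eq.2 (mul_left_cancel' h).symm)

/-- A half-isomorphism treats all products with a given left factor in the same way. -/
theorem map_mul_or (hf : IsHalfIsomorphism f) (hQ : IsAutomorphic Q) (hQ' : IsAutomorphic Q')
    (hdQ : IsUniquelyTwoDivisible Q) (hdQ' : IsUniquelyTwoDivisible Q') (x : Q) :
    (∀ y, f (x * y) = f x * f y) ∨ ∀ y, f (x * y) = f y * f x := by
  have hB := hf.isBruckHom hQ hQ'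
  have hinj {y : Q} (h : conjugation (f x) (conjugation (f x) (f y)) = f y) :
      f x * f y = f y * f x :=
    conjugation_eq_self_iff.1 (hQ'.conjugation_eq_self_of_sq hdQ' h)
  rcases IsBruckHom.eq_or_eq hQ hQ' hdQ hdQ' (hB.comp (hQ.isBruckHom (conjugation_mem x)))
    ((hQ'.isBruckHom (conjugation_mem (f x))).comp hB)
    ((hQ'.isBruckHom (inv_mem (conjugation_mem (f x)))).comp hB)
    (hf.map_conjugation_or hQ hQ' x) with h | h
  · refine Or.inl fun y => (hf.map_mul x y).elim id fun h1 => ?_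
    rw [h1]
    rcases hf.map_mul y x with h2 | h2
    · exact (hf.map_mul_comm hQ hQ' (hf.1.1 (h1.trans h2.symm))).symm
    · have h3 := hf.map_mul x (conjugation x y)
      rw [mul_conjugation, h2, show f (conjugation x y) = conjugation (f x) (f y) from h y] at h3
      rcases h3 with h3 | h3
      · exact (h3.trans (mul_conjugation _ _)).symm
      -- Here the square of the conjugation by f x fixes f y, so by the absence of 2-cycles f x and
      -- f y commute.
      · rw [← mul_conjugation (f x) (conjugation (f x) (f y))] at h3
        exact (hinj (mul_left_cancel' h3).symm).symm
  · refine Or.inr fun y => (hf.map_mul x y).elim (fun h1 => ?_) id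
    rw [h1]
    rcases hf.map_mul y x with h2 | h2
    · have h3 := hf.map_mul x (conjugation x y)
      rw [mul_conjugation, h2,
        show f (conjugation x y) = (conjugation (f x))⁻¹ (f y) from h y] at h3
      rcases h3 with h3 | h3
      · rw [← mul_conjugation] at h3
        exact hinj (Equiv.Perm.eq_inv_iff_eq.1 (mul_left_cancel' h3))
      · rw [← mul_conjugation (f x) ((conjugation (f x))⁻¹ (f y)), perm_apply_inv] at h3
        exact h3.symm
    · exact hf.map_mul_comm hQ hQ' (hf.1.1 (h1.trans h2.symm))

theorem isTrivial (hf : IsHalfIsomorphism f) (hQ : IsAutomorphic Q) (hQ' : IsAutomorphic Q')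
    (hdQ : IsUniquelyTwoDivisible Q) (hdQ' : IsUniquelyTwoDivisible Q') :
    IsTrivialHalfIsomorphism f := by
  have hor := hf.map_mul_or hQ hQ' hdQ hdQ'
  -- Elements of opposite types commute, because f(ab) and f(ba) are then the same product.
  have hcomm {a b : Q} (ha : ∀ y, f (a * y) = f a * f y) (hb : ∀ y, f (b * y) = f y * f b) :
      a * b = b * a := hf.1.1 (by rw [ha, hb])
  have hcent {a b w : Q} (h1 : w * a = a * w) (h2 : w * (a * b) = (a * b) * w) :
      w * b = b * w := by
    rw [← conjugation_eq_self_iff] at h1 h2 ⊢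
    rw [hQ _ (conjugation_mem w), h1] at h2
    exact mul_left_cancel' h2
  by_contra hne
  simp only [IsTrivialHalfIsomorphism, IsIsomorphism, IsAntiIsomorphism, hf.1, true_and, not_or,
    not_forall] at hne
  obtain ⟨⟨y, w, hyw⟩, x, z, hxz⟩ := hne
  have hx := (hor x).resolve_right fun h => hxz (h z)
  have hy := (hor y).resolve_left fun h => hyw (h w)
  have hyw' : y * w ≠ w * y := fun h => hyw (by rw [hy, hf.map_mul_comm hQ hQ' h])
  have hxz' : x * z ≠ z * x := fun h => hxz (by rw [hx, hf.map_mul_comm hQ hQ' h])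
  have hw := (hor w).resolve_left fun h => hyw' (hcomm h hy).symm
  have hz := (hor z).resolve_right fun h => hxz' (hcomm hx h)
  have hxy := hcomm hx hy
  -- Whatever the type of xy, it and one of its factors are of the type opposite to w or to z. That
  -- element commutes with both, hence with the other factor, a contradiction.
  rcases hor (x * y) with h | h
  · exact hyw' (hcent (hcomm hx hw).symm (hcomm h hw).symm).symm
  · refine hxz' (hcent (hcomm hz hy) ?_).symm
    rw [← hxy]
    exact hcomm hz h

end IsHalfIsomorphism

end HalfIsomorphism

end Loop

theorem corollary4p2 {Q Q' : Type*} [Loop Q] [Loop Q']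
    (hQ : Loop.IsAutomorphic Q) (hQ' : Loop.IsAutomorphic Q')
    (hdQ : Loop.IsUniquelyTwoDivisible Q) (hdQ' : Loop.IsUniquelyTwoDivisible Q')
    (f : Q → Q') (hf : Loop.IsHalfIsomorphism f) :
    Loop.IsTrivialHalfIsomorphism f :=
  hf.isTrivial hQ hQ' hdQ hdQ'
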